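/- **Definitions.** An $\mathbf{O}$-category is a category in which every hom-set is a dcpo (a partial order in which every nonempty directed subset has a supremum) and composition is Scott-continuous; products of $\mathbf{O}$-categories carry the componentwise order. A functor between $\mathbf{O}$-categories is locally continuous if its action on every hom-set is Scott-continuous. An embedding is a morphism $e : X \to Y$ for which there is a (necessarily unique) $e^p : Y \to X$ with $e^p \circ e = \mathrm{id}_X$ and $e \circ e^p \sqsubseteq \mathrm{id}_Y$. An $\mathbf{O}$-colimit of an $\omega$-chain of embeddings is a cocone $\kappa$ of embeddings with nadir $X$, say, such that $(\kappa_n \circ \kappa_n^p)_n$ is an ascending chain with supremum $\mathrm{id}_X$. An $\mathbf{O}$-category supports canonical fixed points if it has an initial object $\bot$, it has zero morphisms, each of which is the least element of its hom-set, and every $\omega$-chain of embeddings in it has an $\mathbf{O}$-colimit. This property passes to products of two such categories. Let $\mathbf{E}$ support canonical fixed points, and fix a choice of an initial object and of an $\mathbf{O}$-colimit for every $\omega$-chain of embeddings in $\mathbf{E}$. For an $\mathbf{O}$-category $\mathbf{D}$ and a locally continuous $F : \mathbf{D} \times \mathbf{E} \to \mathbf{E}$, the dagger $F^\dagger : \mathbf{D}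 \to \mathbf{E}$ is the following locally continuous functor. It sends an object $D$ to the chosen $\mathbf{O}$-colimit of $\bot \to F_D\bot \to F_D^2\bot \to \cdots$, where $F_D = F(D,-)$. It sends $f : D \to D'$ to $\bigsqcup_n \gamma_n \circ \eta^{(n)}_\bot \circ \phi_n^p$, where $\phi$ and $\gamma$ are the chosen $\mathbf{O}$-colimits for $F_D$ and $F_{D'}$, and $\eta^{(n)} : F_D^n \Rightarrow F_{D'}^n$ is the $n$-fold horizontal composite of $\eta = F(f,-) : F_D \Rightarrow F_{D'}$. **Proposition (Pairing identity, Bekič's rule).** Let $\mathbf{A}$, $\mathbf{B}$ and $\mathbf{C}$ be small $\mathbf{O}$-categories, and assume that $\mathbf{B}$ and $\mathbf{C}$ support canonical fixed points. Let arbitrary choices of initial objects and $\mathbf{O}$-colimits as above be made in $\mathbf{B}$, in $\mathbf{C}$ and in $\mathbf{B} \times \mathbf{C}$. Let $F : \mathbf{A} \times \mathbf{B} \times \mathbf{C} \to \mathbf{B}$ and $G : \mathbf{A} \times \mathbf{B} \times \mathbf{C} \to \mathbf{C}$ be locally continuous functors. Let $G^\dagger : \mathbf{A} \times \mathbf{B}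 \to \mathbf{C}$ be the dagger of $G$ regarded as a functor $(\mathbf{A} \times \mathbf{B}) \times \mathbf{C} \to \mathbf{C}$, and set $$H = F \circ \langle \mathrm{id}_{\mathbf{A} \times \mathbf{B}}, G^\dagger \rangle : \mathbf{A} \times \mathbf{B} \to \mathbf{B}.$$ Then there is a natural isomorphism $$\langle F, G \rangle^\dagger \;\cong\; \langle H^\dagger,\; G^\dagger \circ \langle \mathrm{id}_{\mathbf{A}}, H^\dagger \rangle \rangle : \mathbf{A} \to \mathbf{B} \times \mathbf{C}.$$ -/

import Mathlib

open CategoryTheory CategoryTheory.Limits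

universe v v₁ v₂ v₃ u u₁ u₂ u₃

namespace OCat

/-- An `O`-category: every hom-set is a dcpo (every nonempty directed subset has a supremum) and
composition is jointly Scott-continuous. -/
class OCategory (K : Type u) [Category.{v} K] where
  /-- The order on each hom-set. -/
  homOrder : ∀ X Y : K, PartialOrder (X ⟶ Y)
  exists_isLUB : ∀ {X Y : K} (d : Set (X ⟶ Y)), d.Nonempty → DirectedOn (· ≤ ·) d →
    ∃ s : X ⟶ Y, IsLUB d s
  comp_continuous : ∀ X Y Z : K,
    ScottContinuous (fun q : (X ⟶ Y) × (Y ⟶ Z) => q.1 ≫ q.2)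

attribute [reducible, instance] OCategory.homOrder

section Basic

variable {K : Type u} [Category.{v} K] [OCategory K]

theorem comp_mono {X Y Z : K} {f f' : X ⟶ Y} {g g' : Y ⟶ Z} (hf : f ≤ f') (hg : g ≤ g') :
    f ≫ g ≤ f' ≫ g' :=
  (OCategory.comp_continuous X Y Z).monotone (show (f, g) ≤ (f', g') from ⟨hf, hg⟩)

theorem comp_right_continuous {X Y Z : K} (f : X ⟶ Y) :
    ScottContinuous (fun g : Y ⟶ Z => f ≫ g) :=
  ScottContinuous.comp (g := fun q : (X ⟶ Y) × (Y ⟶ Z) => q.1 ≫ q.2)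
    (ScottContinuous.prodMk (ScottContinuous.const f) ScottContinuous.id)
    (OCategory.comp_continuous X Y Z)

theorem comp_left_continuous {X Y Z : K} (g : Y ⟶ Z) :
    ScottContinuous (fun f : X ⟶ Y => f ≫ g) :=
  ScottContinuous.comp (g := fun q : (X ⟶ Y) × (Y ⟶ Z) => q.1 ≫ q.2)
    (ScottContinuous.prodMk ScottContinuous.id (ScottContinuous.const g))
    (OCategory.comp_continuous X Y Z)

/-- `(e, p)` is an embedding-projection pair. -/
structure IsEPPair {X Y : K} (e : X ⟶ Y) (p : Y ⟶ X) : Prop where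
  comp_eq : e ≫ p = 𝟙 X
  comp_le : p ≫ e ≤ 𝟙 Y

/-- `e` is an embedding. -/
def IsEmbedding {X Y : K} (e : X ⟶ Y) : Prop := ∃ p : Y ⟶ X, IsEPPair e p

/-- The projection associated with an embedding; it is unique by `IsEPPair.unique`. -/
noncomputable def IsEmbedding.proj {X Y : K} {e : X ⟶ Y} (h : IsEmbedding e) : Y ⟶ X :=
  Classical.choose h

theorem IsEmbedding.isEPPair {X Y : K} {e : X ⟶ Y} (h : IsEmbedding e) : IsEPPair e h.proj :=
  Classical.choose_spec h

theorem IsEPPair.le {X Y : K} {e : X ⟶ Y} {p q : Y ⟶ X} (hp : IsEPPair e p)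
    (hq : IsEPPair e q) : p ≤ q := by
  have h := comp_mono hp.comp_le (le_refl q)
  rw [Category.assoc, hq.comp_eq, Category.comp_id, Category.id_comp] at h
  exact h

theorem IsEPPair.unique {X Y : K} {e : X ⟶ Y} {p q : Y ⟶ X} (hp : IsEPPair e p)
    (hq : IsEPPair e q) : p = q :=
  le_antisymm (hp.le hq) (hq.le hp)

theorem IsEPPair.id (X : K) : IsEPPair (𝟙 X) (𝟙 X) := ⟨by simp, by simp⟩

theorem IsEPPair.comp {X Y Z : K} {e : X ⟶ Y} {p : Y ⟶ X} {e' : Y ⟶ Z} {p' : Z ⟶ Y}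
    (h : IsEPPair e p) (h' : IsEPPair e' p') : IsEPPair (e ≫ e') (p' ≫ p) where
  comp_eq := by
    rw [Category.assoc, ← Category.assoc e', h'.comp_eq, Category.id_comp, h.comp_eq]
  comp_le := by
    have h1 := comp_mono (le_refl p') (comp_mono h.comp_le (le_refl e'))
    rw [Category.id_comp] at h1
    simpa using h1.trans h'.comp_le

theorem IsEmbedding.comp {X Y Z : K} {e : X ⟶ Y} {e' : Y ⟶ Z}
    (h : IsEmbedding e) (h' : IsEmbedding e') : IsEmbedding (e ≫ e') :=
  ⟨_, h.isEPPair.comp h'.isEPPair⟩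

/-- An `ω`-chain of embeddings: an `ω`-chain all of whose morphisms lie in the subcategory of
embeddings. -/
def IsEmbeddingChain (J : ℕ ⥤ K) : Prop := ∀ ⦃m n : ℕ⦄ (f : m ⟶ n), IsEmbedding (J.map f)

/-- A cocone `κ` of embeddings is an `O`-colimit if the `κₙ ∘ κₙᵖ` form an ascending chain with
supremum the identity. -/
structure IsOColimit {J : ℕ ⥤ K} (κ : Cocone J) : Prop where
  isEmbedding : ∀ n, IsEmbedding (κ.ι.app n)
  monotone : Monotone fun n => (isEmbedding n).proj ≫ κ.ι.app n
  isLUB : IsLUB (Set.range fun n => (isEmbedding n).proj ≫ κ.ι.app n) (𝟙 κ.pt)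

variable (K)

/-- `K` has zero morphisms, and each of them is the least element of its hom-set. -/
def HasStrictMorphisms : Prop :=
  ∃ z : HasZeroMorphisms K, ∀ (X Y : K) (f : X ⟶ Y), (z.zero X Y).zero ≤ f

/-- Every `ω`-chain of embeddings has an `O`-colimit. -/
def OCocomplete : Prop :=
  ∀ J : ℕ ⥤ K, IsEmbeddingChain J → ∃ κ : Cocone J, IsOColimit κ

/-- `K` supports canonical fixed points. -/
class SupportsCFP : Prop where
  hasInitial : HasInitial K
  strict : HasStrictMorphisms K
  cocomplete : OCocomplete K

/-- A choice of an initial object and of an `O`-colimit for every `ω`-chain of embeddings. -/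
structure CFPChoice where
  /-- The chosen initial object. -/
  bot : K
  /-- Its initiality. -/
  isInitial : IsInitial bot
  /-- The chosen `O`-colimits. -/
  colim : ∀ J : ℕ ⥤ K, IsEmbeddingChain J → Cocone J
  isOColimit : ∀ (J : ℕ ⥤ K) (hJ : IsEmbeddingChain J), IsOColimit (colim J hJ)

instance [h : SupportsCFP K] : Nonempty (CFPChoice K) := by
  have := h.hasInitial
  exact ⟨⟨⊥_ K, initialIsInitial, fun J hJ => Classical.choose (h.cocomplete J hJ),
    fun J hJ => Classical.choose_spec (h.cocomplete J hJ)⟩⟩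

variable {K}

section Mediating

variable {J : ℕ ⥤ K} {κ : Cocone J}

theorem IsOColimit.monotone_desc (h : IsOColimit κ) (hJ : IsEmbeddingChain J) (s : Cocone J) :
    Monotone fun n => (h.isEmbedding n).proj ≫ s.ι.app n := by
  intro m n hmn
  have hj := hJ (homOfLE hmn)
  have e : (h.isEmbedding m).proj = (h.isEmbedding n).proj ≫ hj.proj := by
    refine (h.isEmbedding m).isEPPair.unique ?_
    have := hj.isEPPair.comp (h.isEmbedding n).isEPPair
    rwa [Cocone.w] at this
  have hs : s.ι.app m = J.map (homOfLE hmn) ≫ s.ι.app n := (Cocone.w s _).symm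
  have := comp_mono (le_refl (h.isEmbedding n).proj)
    (comp_mono hj.isEPPair.comp_le (le_refl (s.ι.app n)))
  simp only [Category.id_comp] at this
  simp only [e, hs]
  simpa using this

theorem IsOColimit.exists_desc (h : IsOColimit κ) (hJ : IsEmbeddingChain J) (s : Cocone J) :
    ∃ θ : κ.pt ⟶ s.pt, IsLUB (Set.range fun n => (h.isEmbedding n).proj ≫ s.ι.app n) θ :=
  OCategory.exists_isLUB _ (Set.range_nonempty _)
    (directedOn_range.2 (h.monotone_desc hJ s).directed_le)

/-- The mediating morphism `⨆ₙ sₙ ∘ κₙᵖ` from an `O`-colimit `κ` to a cocone `s`. -/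
noncomputable def IsOColimit.desc (h : IsOColimit κ) (hJ : IsEmbeddingChain J) (s : Cocone J) :
    κ.pt ⟶ s.pt :=
  Classical.choose (h.exists_desc hJ s)

theorem IsOColimit.isLUB_desc (h : IsOColimit κ) (hJ : IsEmbeddingChain J) (s : Cocone J) :
    IsLUB (Set.range fun n => (h.isEmbedding n).proj ≫ s.ι.app n) (h.desc hJ s) :=
  Classical.choose_spec (h.exists_desc hJ s)

theorem IsOColimit.fac (h : IsOColimit κ) (hJ : IsEmbeddingChain J) (s : Cocone J) (n : ℕ) :
    κ.ι.app n ≫ h.desc hJ s = s.ι.app n := by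
  have hm := h.monotone_desc hJ s
  have h1 := comp_right_continuous (κ.ι.app n) (Set.range_nonempty _)
    (directedOn_range.2 hm.directed_le) (h.isLUB_desc hJ s)
  have key : ∀ m, n ≤ m → κ.ι.app n ≫ (h.isEmbedding m).proj ≫ s.ι.app m = s.ι.app n := by
    intro m hnm
    rw [← Cocone.w κ (homOfLE hnm), Category.assoc, ← Category.assoc (κ.ι.app m),
      (h.isEmbedding m).isEPPair.comp_eq, Category.id_comp, Cocone.w]
  refine h1.unique ⟨?_, fun u hu => ?_⟩
  · rintro _ ⟨_, ⟨m, rfl⟩, rfl⟩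
    have := comp_mono (le_refl (κ.ι.app n)) (hm (le_max_right n m))
    rw [key _ (le_max_left n m)] at this
    exact this
  · have := hu ⟨_, ⟨n, rfl⟩, rfl⟩
    simp only [key n le_rfl] at this
    exact this

theorem IsOColimit.hom_ext (h : IsOColimit κ) {X : K} {f g : κ.pt ⟶ X}
    (w : ∀ n, κ.ι.app n ≫ f = κ.ι.app n ≫ g) : f = g := by
  have hf := comp_left_continuous f (Set.range_nonempty _)
    (directedOn_range.2 h.monotone.directed_le) h.isLUB
  have hg := comp_left_continuous g (Set.range_nonempty _)
    (directedOn_range.2 h.monotone.directed_le) h.isLUB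
  simp only [Category.id_comp] at hf hg
  refine hf.unique ?_
  convert hg using 1
  rw [← Set.range_comp, ← Set.range_comp]
  congr 1
  funext n
  simp [w n]

end Mediating

/-- The unique morphisms out of an initial object are embeddings. -/
theorem isEmbedding_to [h : SupportsCFP K] (c : CFPChoice K) (X : K) :
    IsEmbedding (c.isInitial.to X) := by
  obtain ⟨z, hz⟩ := h.strict
  refine ⟨0, c.isInitial.hom_ext _ _, ?_⟩
  rw [zero_comp]
  exact hz X X (𝟙 X)

end Basic

section Functors

variable {D : Type u₁} [Category.{v₁} D] [OCategory D]
variable {E : Type u₂} [Category.{v₂} E] [OCategory E]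
variable {K : Type u} [Category.{v} K] [OCategory K]

/-- A functor is locally continuous if its action on each hom-set is Scott-continuous. -/
def LocallyContinuous (D : Type u₁) [Category.{v₁} D] [OCategory D]
    (E : Type u₂) [Category.{v₂} E] [OCategory E] : ObjectProperty (D ⥤ E) :=
  fun F => ∀ X Y : D, ScottContinuous (fun f : X ⟶ Y => F.map f)

/-- The category of locally continuous functors and natural transformations. -/
abbrev LCFunctor (D : Type u₁) [Category.{v₁} D] [OCategory D]
    (E : Type u₂) [Category.{v₂} E] [OCategory E] :=
  (LocallyContinuous D E).FullSubcategory

theorem LCFunctor.isEPPair_map (F : LCFunctor D E) {X Y : D} {e : X ⟶ Y} {p : Y ⟶ X}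
    (h : IsEPPair e p) : IsEPPair (F.obj.map e) (F.obj.map p) where
  comp_eq := by rw [← F.obj.map_comp, h.comp_eq, F.obj.map_id]
  comp_le := by
    have := (F.property Y Y).monotone h.comp_le
    simpa using this

/-- The identity functor. -/
def LCFunctor.id (D : Type u₁) [Category.{v₁} D] [OCategory D] : LCFunctor D D :=
  ⟨𝟭 D, fun _ _ => ScottContinuous.id⟩

/-- The composite `G ∘ F`, written in diagrammatic order. -/
def LCFunctor.comp (F : LCFunctor D E) (G : LCFunctor E K) : LCFunctor D K :=
  ⟨F.obj ⋙ G.obj, fun X Y => ScottContinuous.comp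
    (g := fun f : F.obj.obj X ⟶ F.obj.obj Y => G.obj.map f) (F.property X Y) (G.property _ _)⟩

end Functors

section FIX

variable {K : Type u} [Category.{v} K] [OCategory K] (c : CFPChoice K)

/-- The objects `Fⁿ ⊥`. -/
def iter (F : K ⥤ K) : ℕ → K
  | 0 => c.bot
  | n + 1 => F.obj (iter F n)

/-- The morphisms `Fⁿ ⊥ : Fⁿ ⊥ ⟶ Fⁿ (F ⊥)`. -/
def iterStep (F : K ⥤ K) : ∀ n, iter c F n ⟶ iter c F (n + 1)
  | 0 => c.isInitial.to _
  | n + 1 => F.map (iterStep F n)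

/-- The `ω`-chain `⊥ ⟶ F ⊥ ⟶ F² ⊥ ⟶ ⋯`. -/
def chain (F : K ⥤ K) : ℕ ⥤ K := Functor.ofSequence (iterStep c F)

/-- The components at `⊥` of the horizontal iterates of `η`. -/
def iterMap {F G : K ⥤ K} (η : F ⟶ G) : ∀ n, iter c F n ⟶ iter c G n
  | 0 => 𝟙 _
  | n + 1 => F.map (iterMap η n) ≫ η.app (iter c G n)

theorem iterMap_step {F G : K ⥤ K} (η : F ⟶ G) (n : ℕ) :
    iterStep c F n ≫ iterMap c η (n + 1) = iterMap c η n ≫ iterStep c G n := by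
  induction n with
  | zero => exact c.isInitial.hom_ext _ _
  | succ n ih =>
    change F.map (iterStep c F n) ≫ F.map (iterMap c η (n + 1)) ≫ η.app _ =
      (F.map (iterMap c η n) ≫ η.app _) ≫ G.map (iterStep c G n)
    rw [← Category.assoc, ← F.map_comp, ih, F.map_comp, Category.assoc, Category.assoc,
      η.naturality]

/-- The morphism of `ω`-chains induced by `η`. -/
def chainMap {F G : K ⥤ K} (η : F ⟶ G) : chain c F ⟶ chain c G :=
  NatTrans.ofSequence (iterMap c η) (fun n => by
    unfold chain
    rw [Functor.ofSequence_map_homOfLE_succ, Functor.ofSequence_map_homOfLE_succ]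
    exact iterMap_step c η n)

theorem iterMap_id (F : K ⥤ K) (n : ℕ) : iterMap c (𝟙 F) n = 𝟙 _ := by
  induction n with
  | zero => rfl
  | succ n ih => simp only [iterMap, ih]; simp [iter]

theorem iterMap_comp {F G H : K ⥤ K} (η : F ⟶ G) (ρ : G ⟶ H) (n : ℕ) :
    iterMap c (η ≫ ρ) n = iterMap c η n ≫ iterMap c ρ n := by
  induction n with
  | zero => exact (Category.id_comp _).symm
  | succ n ih =>
    change F.map (iterMap c (η ≫ ρ) n) ≫ η.app _ ≫ ρ.app _ =
      (F.map (iterMap c η n) ≫ η.app _) ≫ G.map (iterMap c ρ n) ≫ ρ.app _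
    rw [ih, F.map_comp, Category.assoc, Category.assoc, η.naturality_assoc]

variable [SupportsCFP K]

theorem isEmbedding_iterStep (F : LCFunctor K K) (n : ℕ) : IsEmbedding (iterStep c F.obj n) := by
  induction n with
  | zero => exact isEmbedding_to c _
  | succ n ih => exact ⟨_, F.isEPPair_map ih.isEPPair⟩

theorem isEmbeddingChain_chain (F : LCFunctor K K) : IsEmbeddingChain (chain c F.obj) := by
  intro m n f
  obtain ⟨k, rfl⟩ := Nat.exists_eq_add_of_le (leOfHom f)
  obtain rfl := Subsingleton.elim f (homOfLE (by lia))
  induction k with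
  | zero =>
    have : (homOfLE (by lia) : m ⟶ m + 0) = 𝟙 m := Subsingleton.elim _ _
    rw [this, (chain c F.obj).map_id]
    exact ⟨_, IsEPPair.id _⟩
  | succ k ih =>
    have : (homOfLE (by lia) : m ⟶ m + (k + 1)) =
        (homOfLE (by lia) : m ⟶ m + k) ≫ homOfLE (Nat.le_add_right (m + k) 1) :=
      Subsingleton.elim _ _
    rw [this, (chain c F.obj).map_comp]
    refine ih.comp ?_
    unfold chain
    rw [Functor.ofSequence_map_homOfLE_succ]
    exact isEmbedding_iterStep c F _

/-- The chosen `O`-colimit of `⊥ ⟶ F ⊥ ⟶ F² ⊥ ⟶ ⋯`. -/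
def fixCocone (F : LCFunctor K K) : Cocone (chain c F.obj) :=
  c.colim _ (isEmbeddingChain_chain c F)

theorem isOColimit_fixCocone (F : LCFunctor K K) : IsOColimit (fixCocone c F) :=
  c.isOColimit _ _

/-- The components of the chosen `O`-colimit. -/
def fixι (F : LCFunctor K K) (n : ℕ) : iter c F.obj n ⟶ (fixCocone c F).pt :=
  (fixCocone c F).ι.app n

/-- The cocone `γₙ ∘ η⁽ⁿ⁾` under the chain of `F`, with `γ` the chosen `O`-colimit for `G`. -/
def fixMapCocone {F G : LCFunctor K K} (η : F ⟶ G) : Cocone (chain c F.obj) where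
  pt := (fixCocone c G).pt
  ι := chainMap c η.hom ≫ (fixCocone c G).ι

/-- The morphism `⨆ₙ γₙ ∘ η⁽ⁿ⁾ ∘ φₙᵖ`, with `φ` and `γ` the chosen `O`-colimits for `F` and
`G`. -/
noncomputable def fixMap {F G : LCFunctor K K} (η : F ⟶ G) :
    (fixCocone c F).pt ⟶ (fixCocone c G).pt :=
  (isOColimit_fixCocone c F).desc (isEmbeddingChain_chain c F) (fixMapCocone c η)

theorem fixι_fixMap {F G : LCFunctor K K} (η : F ⟶ G) (n : ℕ) :
    fixι c F n ≫ fixMap c η = iterMap c η.hom n ≫ fixι c G n :=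
  (isOColimit_fixCocone c F).fac (isEmbeddingChain_chain c F) (fixMapCocone c η) n

theorem fix_hom_ext {F : LCFunctor K K} {X : K} {f g : (fixCocone c F).pt ⟶ X}
    (w : ∀ n, fixι c F n ≫ f = fixι c F n ≫ g) : f = g :=
  (isOColimit_fixCocone c F).hom_ext w

/-- The canonical-fixed-point functor: on objects the chosen `O`-colimit of
`⊥ ⟶ F ⊥ ⟶ F² ⊥ ⟶ ⋯`, on morphisms `η ↦ ⨆ₙ γₙ ∘ η⁽ⁿ⁾ ∘ φₙᵖ`. -/
noncomputable def FIX : LCFunctor K K ⥤ K where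
  obj F := (fixCocone c F).pt
  map η := fixMap c η
  map_id F := by
    refine fix_hom_ext c fun n => ?_
    rw [fixι_fixMap]
    change iterMap c (𝟙 F.obj) n ≫ _ = _
    rw [iterMap_id, Category.comp_id, Category.id_comp]
  map_comp {F G H} η ρ := by
    refine fix_hom_ext c fun n => ?_
    rw [fixι_fixMap]
    change iterMap c (η.hom ≫ ρ.hom) n ≫ _ = _
    rw [iterMap_comp, ← Category.assoc, fixι_fixMap, Category.assoc, Category.assoc, fixι_fixMap]

end FIX

section Products

variable {A : Type u₁} [Category.{v₁} A] [OCategory A]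
variable {B : Type u₂} [Category.{v₂} B] [OCategory B]
variable {C : Type u₃} [Category.{v₃} C] [OCategory C]

/-- Hom-sets of a product category carry the product order. -/
instance : OCategory (B × C) where
  homOrder X Y := inferInstanceAs (PartialOrder ((X.1 ⟶ Y.1) × (X.2 ⟶ Y.2)))
  exists_isLUB {X Y} d hne hd := by
    obtain ⟨s, hs⟩ := OCategory.exists_isLUB (Prod.fst '' d) (hne.image _)
      (hd.mono_comp fun _ _ h => h.1)
    obtain ⟨t, ht⟩ := OCategory.exists_isLUB (Prod.snd '' d) (hne.image _)
      (hd.mono_comp fun _ _ h => h.2)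
    exact ⟨(s, t), isLUB_prod.2 ⟨hs, ht⟩⟩
  comp_continuous X Y Z := by
    refine ScottContinuous.prodMk
      (f := fun q : ((X.1 ⟶ Y.1) × (X.2 ⟶ Y.2)) × ((Y.1 ⟶ Z.1) × (Y.2 ⟶ Z.2)) =>
        q.1.1 ≫ q.2.1)
      (g := fun q => q.1.2 ≫ q.2.2) ?_ ?_
    · exact ScottContinuous.comp (g := fun q : (X.1 ⟶ Y.1) × (Y.1 ⟶ Z.1) => q.1 ≫ q.2)
        (f := fun q : ((X.1 ⟶ Y.1) × (X.2 ⟶ Y.2)) × ((Y.1 ⟶ Z.1) × (Y.2 ⟶ Z.2)) =>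
          (q.1.1, q.2.1)) (by fun_prop) (OCategory.comp_continuous _ _ _)
    · exact ScottContinuous.comp (g := fun q : (X.2 ⟶ Y.2) × (Y.2 ⟶ Z.2) => q.1 ≫ q.2)
        (f := fun q : ((X.1 ⟶ Y.1) × (X.2 ⟶ Y.2)) × ((Y.1 ⟶ Z.1) × (Y.2 ⟶ Z.2)) =>
          (q.1.2, q.2.2)) (by fun_prop) (OCategory.comp_continuous _ _ _)

theorem isEPPair_prod {X Y : B × C} {e : X ⟶ Y} {p : Y ⟶ X} :
    IsEPPair e p ↔ IsEPPair e.1 p.1 ∧ IsEPPair e.2 p.2 :=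
  ⟨fun h => ⟨⟨congrArg Prod.fst h.comp_eq, h.comp_le.1⟩,
    ⟨congrArg Prod.snd h.comp_eq, h.comp_le.2⟩⟩,
   fun h => ⟨Prod.ext h.1.comp_eq h.2.comp_eq, ⟨h.1.comp_le, h.2.comp_le⟩⟩⟩

/-- Products of categories supporting canonical fixed points support canonical fixed points. -/
instance [hB : SupportsCFP B] [hC : SupportsCFP C] : SupportsCFP (B × C) where
  hasInitial := by
    have := hB.hasInitial
    have := hC.hasInitial
    exact (IsInitial.ofUniqueHom (X := ((⊥_ B, ⊥_ C) : B × C))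
      (fun Y => (initial.to Y.1, initial.to Y.2))
      (fun Y m => Prod.ext (initialIsInitial.hom_ext _ _)
        (initialIsInitial.hom_ext _ _))).hasInitial
  strict := by
    obtain ⟨z, hz⟩ := hB.strict
    obtain ⟨w, hw⟩ := hC.strict
    exact ⟨{ zero := fun X Y => ⟨((z.zero X.1 Y.1).zero, (w.zero X.2 Y.2).zero)⟩
             comp_zero := fun f Z => Prod.ext (z.comp_zero f.1 Z.1) (w.comp_zero f.2 Z.2)
             zero_comp := fun X _ _ f => Prod.ext (z.zero_comp X.1 f.1) (w.zero_comp X.2 f.2) },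
      fun X Y f => ⟨hz _ _ f.1, hw _ _ f.2⟩⟩
  cocomplete J hJ := by
    obtain ⟨κ, hκ⟩ := hB.cocomplete (J ⋙ CategoryTheory.Prod.fst B C)
      (fun m n f => ⟨(hJ f).proj.1, (isEPPair_prod.1 (hJ f).isEPPair).1⟩)
    obtain ⟨τ, hτ⟩ := hC.cocomplete (J ⋙ CategoryTheory.Prod.snd B C)
      (fun m n f => ⟨(hJ f).proj.2, (isEPPair_prod.1 (hJ f).isEPPair).2⟩)
    let σ : Cocone J :=
      { pt := (κ.pt, τ.pt)
        ι := { app := fun n => (κ.ι.app n, τ.ι.app n)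
               naturality := fun m n f => Prod.ext (κ.ι.naturality f) (τ.ι.naturality f) } }
    have hep : ∀ n, IsEPPair (σ.ι.app n)
        ((hκ.isEmbedding n).proj, (hτ.isEmbedding n).proj) := fun n =>
      isEPPair_prod.2 ⟨(hκ.isEmbedding n).isEPPair, (hτ.isEmbedding n).isEPPair⟩
    have hemb : ∀ n, IsEmbedding (σ.ι.app n) := fun n => ⟨_, hep n⟩
    have heq : ∀ n, (hemb n).proj ≫ σ.ι.app n =
        ((hκ.isEmbedding n).proj ≫ κ.ι.app n, (hτ.isEmbedding n).proj ≫ τ.ι.app n) := fun n => by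
      rw [(hemb n).isEPPair.unique (hep n)]
      rfl
    refine ⟨σ, hemb, ?_, ?_⟩
    · intro m n hmn
      simp only [heq]
      exact ⟨hκ.monotone hmn, hτ.monotone hmn⟩
    · simp only [heq]
      refine isLUB_prod.2 ⟨?_, ?_⟩
      · rw [← Set.range_comp]
        exact hκ.isLUB
      · rw [← Set.range_comp]
        exact hτ.isLUB

/-- The pairing `⟨F, G⟩`. -/
def LCFunctor.pair (F : LCFunctor A B) (G : LCFunctor A C) : LCFunctor A (B × C) :=
  ⟨F.obj.prod' G.obj, fun X Y => ScottContinuous.prodMk (F.property X Y) (G.property X Y)⟩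

variable (A B C) in
/-- The associator `(A × B) × C ⟶ A × (B × C)`. -/
def LCFunctor.assoc : LCFunctor ((A × B) × C) (A × (B × C)) :=
  ⟨prod.associator A B C, fun X Y => by
    change ScottContinuous
      (fun q : ((X.1.1 ⟶ Y.1.1) × (X.1.2 ⟶ Y.1.2)) × (X.2 ⟶ Y.2) => (q.1.1, (q.1.2, q.2)))
    fun_prop⟩

end Products

section Dagger

variable {D : Type u₁} [Category.{v₁} D] [OCategory D]
variable {E : Type u₂} [Category.{v₂} E] [OCategory E]

/-- The functor `D ↦ F(D, -)`. -/
def Lam (F : LCFunctor (D × E) E) : D ⥤ LCFunctor E E :=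
  ObjectProperty.lift _ (Functor.curry.obj F.obj) (fun d X Y => by
    refine ScottContinuous.comp (f := fun f : X ⟶ Y => ((𝟙 d, f) : (d, X) ⟶ (d, Y)))
      (g := fun q : (d, X) ⟶ (d, Y) => F.obj.map q) ?_ (F.property _ _)
    exact ScottContinuous.prodMk (ScottContinuous.const (𝟙 d)) ScottContinuous.id)

variable (c : CFPChoice E)

theorem iterMap_Lam_continuous (F : LCFunctor (D × E) E) (X Y : D) (n : ℕ) :
    ScottContinuous (fun f : X ⟶ Y => iterMap c ((Lam F).map f).hom n) := by
  induction n with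
  | zero => exact ScottContinuous.const _
  | succ n ih =>
    have h : (fun f : X ⟶ Y => iterMap c ((Lam F).map f).hom (n + 1)) = fun f =>
        F.obj.map (X := (X, iter c ((Lam F).obj X).obj n)) (Y := (Y, iter c ((Lam F).obj Y).obj n))
          (f, iterMap c ((Lam F).map f).hom n) := by
      funext f
      change F.obj.map (X := (X, _)) (Y := (X, _)) (𝟙 X, iterMap c ((Lam F).map f).hom n) ≫
        F.obj.map (X := (X, _)) (Y := (Y, _)) (f, 𝟙 _) = _
      rw [← F.obj.map_comp]
      congr 1
      exact Prod.ext (Category.id_comp _) (Category.comp_id _)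
    rw [h]
    exact ScottContinuous.comp (ScottContinuous.prodMk ScottContinuous.id ih)
      (F.property (X, iter c ((Lam F).obj X).obj n) (Y, iter c ((Lam F).obj Y).obj n))

variable [SupportsCFP E]

/-- The dagger `F† : D ⟶ E` of `F : D × E ⟶ E`, namely `FIX ∘ ΛF`; so `F† D` is the canonical
fixed point of `F(D, -)`. -/
noncomputable def dagger (F : LCFunctor (D × E) E) : LCFunctor D E :=
  ⟨Lam F ⋙ FIX c, fun X Y => by
    have hcont : ∀ n, ScottContinuous (fun f : X ⟶ Y =>
        ((isOColimit_fixCocone c ((Lam F).obj X)).isEmbedding n).proj ≫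
          (fixMapCocone c ((Lam F).map f)).ι.app n) := fun n =>
      ScottContinuous.comp
        (ScottContinuous.comp (iterMap_Lam_continuous c F X Y n)
          (comp_left_continuous (fixι c ((Lam F).obj Y) n)))
        (comp_right_continuous
          ((isOColimit_fixCocone c ((Lam F).obj X)).isEmbedding n).proj)
    have hlub : ∀ f : X ⟶ Y, IsLUB _ (fixMap c ((Lam F).map f)) := fun f =>
      (isOColimit_fixCocone c ((Lam F).obj X)).isLUB_desc
        (isEmbeddingChain_chain c ((Lam F).obj X)) (fixMapCocone c ((Lam F).map f))
    intro d hne hd a ha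
    refine ⟨?_, fun u hu => ?_⟩
    · rintro _ ⟨f, hf, rfl⟩
      refine (hlub f).2 ?_
      rintro _ ⟨n, rfl⟩
      exact ((hcont n).monotone (ha.1 hf)).trans ((hlub a).1 ⟨n, rfl⟩)
    · refine (hlub a).2 ?_
      rintro _ ⟨n, rfl⟩
      refine (hcont n hne hd ha).2 ?_
      rintro _ ⟨f, hf, rfl⟩
      exact ((hlub f).1 ⟨n, rfl⟩).trans (hu ⟨f, hf, rfl⟩)⟩

end Dagger

section Bekic

variable {A : Type u₁} [Category.{v₁} A] [OCategory A]
variable {B : Type u₂} [Category.{v₂} B] [OCategory B]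
variable {C : Type u₃} [Category.{v₃} C] [OCategory C] [SupportsCFP C]

/-- `G† : A × B ⟶ C` for `G : A × B × C ⟶ C`, with `A × B` as the parameter category. -/
noncomputable def daggerAssoc (cC : CFPChoice C) (G : LCFunctor (A × B × C) C) :
    LCFunctor (A × B) C :=
  dagger cC ((LCFunctor.assoc A B C).comp G)

/-- The functor `H = F ∘ ⟨id, G†⟩ : A × B ⟶ B`. -/
noncomputable def bekicH (cC : CFPChoice C) (F : LCFunctor (A × B × C) B)
    (G : LCFunctor (A × B × C) C) : LCFunctor (A × B) B :=
  (((LCFunctor.id (A × B)).pair (daggerAssoc cC G)).comp (LCFunctor.assoc A B C)).comp F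

end Bekic

end OCat
/-!
An `O`-colimit of embeddings is a colimit in the ambient category, and locally continuous functors
preserve it. By Adámek's theorem `T† d` is therefore an initial algebra of `T(d, -)`, naturally in
`d`, and such a family of initial algebras is unique up to a natural isomorphism; in particular the
choices of initial objects and `O`-colimits do not matter. It remains to see that initial algebras
can be computed one component at a time. If `Q` is a family of initial algebras of `G`, the
`C`-component of a morphism from `(P a, Q(a, P a))` to a `⟨F, G⟩(a, -)`-algebra is a morphism out
of an initial `G`-algebra, so it is determined by the `B`-component. Once it is eliminated, the
condition on the `B`-component says that it is a morphism of algebras of `F ∘ ⟨id, Q⟩`, of which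
`P a` is an initial one.
-/

namespace OCat

section ColimitPreservation

variable {D : Type u₁} [Category.{v₁} D] [OCategory D]
variable {E : Type u₂} [Category.{v₂} E] [OCategory E]
variable {J : ℕ ⥤ D} {κ : Cocone J}

theorem IsOColimit.of_isEPPair {p : ∀ n, κ.pt ⟶ J.obj n} (hp : ∀ n, IsEPPair (κ.ι.app n) (p n))
    (hmono : Monotone fun n => p n ≫ κ.ι.app n)
    (hlub : IsLUB (Set.range fun n => p n ≫ κ.ι.app n) (𝟙 κ.pt)) : IsOColimit κ := by
  have hemb : ∀ n, IsEmbedding (κ.ι.app n) := fun n => ⟨p n, hp n⟩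
  obtain rfl : p = fun n => (hemb n).proj := funext fun n => (hp n).unique (hemb n).isEPPair
  exact ⟨hemb, hmono, hlub⟩

noncomputable def IsOColimit.isColimit (h : IsOColimit κ) (hJ : IsEmbeddingChain J) :
    IsColimit κ where
  desc := h.desc hJ
  fac := h.fac hJ
  uniq s _ hm := h.hom_ext fun n => (hm n).trans (h.fac hJ s n).symm

theorem IsEmbeddingChain.comp (hJ : IsEmbeddingChain J) (T : LCFunctor D E) :
    IsEmbeddingChain (J ⋙ T.obj) :=
  fun _ _ f => ⟨_, T.isEPPair_map (hJ f).isEPPair⟩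

theorem IsOColimit.mapCocone (h : IsOColimit κ) (T : LCFunctor D E) :
    IsOColimit (T.obj.mapCocone κ) := by
  have hmap : (fun n => T.obj.map (h.isEmbedding n).proj ≫ T.obj.map (κ.ι.app n)) =
      fun n => T.obj.map ((h.isEmbedding n).proj ≫ κ.ι.app n) :=
    funext fun n => (T.obj.map_comp _ _).symm
  refine .of_isEPPair (fun n => T.isEPPair_map (h.isEmbedding n).isEPPair) ?_ ?_
  · exact hmap ▸ (T.property _ _).monotone.comp h.monotone
  · have hlub := T.property _ _ (Set.range_nonempty _)
      (directedOn_range.2 h.monotone.directed_le) h.isLUB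
    rw [← Set.range_comp] at hlub
    exact hmap ▸ T.obj.map_id κ.pt ▸ hlub

theorem LCFunctor.preservesColimit (T : LCFunctor D E) (hJ : IsEmbeddingChain J)
    (h : IsOColimit κ) : PreservesColimit J T.obj :=
  preservesColimit_of_preserves_colimit_cocone (h.isColimit hJ)
    ((h.mapCocone T).isColimit (hJ.comp T))

end ColimitPreservation

section Adamek

variable {K : Type u} [Category.{v} K] [OCategory K] (c : CFPChoice K) {F : K ⥤ K}

/-- The components `Fⁿ ⊥ ⟶ κ` of a cocone under `⊥ ⟶ F ⊥ ⟶ F² ⊥ ⟶ ⋯`. -/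
def chainι (κ : Cocone (chain c F)) (n : ℕ) : iter c F n ⟶ κ.pt := κ.ι.app n

theorem chain_map_succ (F : K ⥤ K) (n : ℕ) :
    (chain c F).map (homOfLE (Nat.le_add_right n 1)) = iterStep c F n :=
  Functor.ofSequence_map_homOfLE_succ _ n

theorem iterStep_chainι (κ : Cocone (chain c F)) (n : ℕ) :
    iterStep c F n ≫ chainι c κ (n + 1) = chainι c κ n :=
  (congrArg (· ≫ κ.ι.app (n + 1)) (chain_map_succ c F n)).symm.trans (κ.w _)

/-- The cocone with components `κₙ₊₁` under the image by `F` of the chain `⊥ ⟶ F ⊥ ⟶ ⋯`, which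
is the tail of that chain. -/
def shiftCocone (κ : Cocone (chain c F)) : Cocone (chain c F ⋙ F) where
  pt := κ.pt
  ι := NatTrans.ofSequence (F := chain c F ⋙ F) (G := (Functor.const ℕ).obj κ.pt)
    (fun n => chainι c κ (n + 1)) fun n => by
      rw [Functor.comp_map, chain_map_succ]
      exact (iterStep_chainι c κ (n + 1)).trans (Category.comp_id _).symm

/-- The morphisms `Fⁿ ⊥ ⟶ A` induced by the structure of an `F`-algebra `A`. -/
def iterDesc (A : Endofunctor.Algebra F) : ∀ n, iter c F n ⟶ A.a
  | 0 => c.isInitial.to A.a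
  | n + 1 => F.map (iterDesc A n) ≫ A.str

theorem iterStep_iterDesc (A : Endofunctor.Algebra F) (n : ℕ) :
    iterStep c F n ≫ iterDesc c A (n + 1) = iterDesc c A n := by
  induction n with
  | zero => exact c.isInitial.hom_ext _ _
  | succ n ih =>
    change F.map (iterStep c F n) ≫ F.map (iterDesc c A (n + 1)) ≫ A.str =
      F.map (iterDesc c A n) ≫ A.str
    rw [← F.map_comp_assoc, ih]

/-- The cocone under `⊥ ⟶ F ⊥ ⟶ F² ⊥ ⟶ ⋯` induced by the structure of an `F`-algebra. -/
def algebraCocone (A : Endofunctor.Algebra F) : Cocone (chain c F) where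
  pt := A.a
  ι := NatTrans.ofSequence (F := chain c F) (G := (Functor.const ℕ).obj A.a) (iterDesc c A)
    fun n => by
      rw [chain_map_succ]
      exact (iterStep_iterDesc c A n).trans (Category.comp_id _).symm

variable {κ : Cocone (chain c F)} [PreservesColimit (chain c F) F]

/-- The structure of an `F`-algebra on a colimit `κ` of `⊥ ⟶ F ⊥ ⟶ F² ⊥ ⟶ ⋯` that `F` preserves;
it is determined by `F κₙ ↦ κₙ₊₁`. -/
noncomputable def colimitStr (hκ : IsColimit κ) : F.obj κ.pt ⟶ κ.pt :=
  (isColimitOfPreserves F hκ).desc (shiftCocone c κ)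

theorem map_chainι_colimitStr (hκ : IsColimit κ) (n : ℕ) :
    F.map (chainι c κ n) ≫ colimitStr c hκ = chainι c κ (n + 1) :=
  (isColimitOfPreserves F hκ).fac (shiftCocone c κ) n

theorem map_chainι_colimitStr_assoc (hκ : IsColimit κ) (n : ℕ) {X : K} (g : κ.pt ⟶ X) :
    F.map (chainι c κ n) ≫ colimitStr c hκ ≫ g = chainι c κ (n + 1) ≫ g :=
  (Category.assoc _ _ _).symm.trans (congrArg (· ≫ g) (map_chainι_colimitStr c hκ n))

/-- A colimit of `⊥ ⟶ F ⊥ ⟶ F² ⊥ ⟶ ⋯` that `F` preserves, as an `F`-algebra. -/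
noncomputable abbrev colimitAlgebra (hκ : IsColimit κ) : Endofunctor.Algebra F :=
  ⟨κ.pt, colimitStr c hκ⟩

/-- The algebra morphism from the colimit of `⊥ ⟶ F ⊥ ⟶ F² ⊥ ⟶ ⋯` to an algebra. -/
noncomputable def colimitAlgebraDesc (hκ : IsColimit κ) (A : Endofunctor.Algebra F) :
    colimitAlgebra c hκ ⟶ A where
  f := hκ.desc (algebraCocone c A)
  h := (isColimitOfPreserves F hκ).hom_ext fun n => by
    let g : κ.pt ⟶ A.a := hκ.desc (algebraCocone c A)
    have hg (m : ℕ) : chainι c κ m ≫ g = iterDesc c A m := hκ.fac _ m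
    change F.map (chainι c κ n) ≫ F.map g ≫ A.str = F.map (chainι c κ n) ≫ colimitStr c hκ ≫ g
    rw [← F.map_comp_assoc, hg]
    exact ((map_chainι_colimitStr_assoc c hκ n g).trans (hg (n + 1))).symm

theorem chainι_colimitAlgebra_hom (hκ : IsColimit κ) {A : Endofunctor.Algebra F}
    (m : colimitAlgebra c hκ ⟶ A) (n : ℕ) : chainι c κ n ≫ m.f = iterDesc c A n := by
  induction n with
  | zero => exact c.isInitial.hom_ext _ _
  | succ n ih =>
    refine (map_chainι_colimitStr_assoc c hκ n m.f).symm.trans ?_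
    rw [← m.h, ← F.map_comp_assoc, ih]
    rfl

/-- Adámek's theorem. -/
noncomputable def isInitialColimitAlgebra (hκ : IsColimit κ) :
    IsInitial (colimitAlgebra c hκ) :=
  .ofUniqueHom (colimitAlgebraDesc c hκ) fun A m =>
    Endofunctor.Algebra.ext <| hκ.hom_ext fun n =>
      (chainι_colimitAlgebra_hom c hκ m n).trans (hκ.fac (algebraCocone c A) n).symm

end Adamek

section FixAlgebra

variable {K : Type u} [Category.{v} K] [OCategory K] [SupportsCFP K] (c : CFPChoice K)

noncomputable def isColimitFixCocone (T : LCFunctor K K) : IsColimit (fixCocone c T) :=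
  (isOColimit_fixCocone c T).isColimit (isEmbeddingChain_chain c T)

instance preservesColimit_chain (T : LCFunctor K K) :
    PreservesColimit (chain c T.obj) T.obj :=
  T.preservesColimit (isEmbeddingChain_chain c T) (isOColimit_fixCocone c T)

/-- The structure `T (FIX T) ⟶ FIX T` of a `T`-algebra on the canonical fixed point of `T`. -/
noncomputable def fixStr (T : LCFunctor K K) :
    T.obj.obj (fixCocone c T).pt ⟶ (fixCocone c T).pt :=
  colimitStr c (isColimitFixCocone c T)

noncomputable def isInitialFixAlgebra (T : LCFunctor K K) :
    IsInitial (⟨(fixCocone c T).pt, fixStr c T⟩ : Endofunctor.Algebra T.obj) :=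
  isInitialColimitAlgebra c (isColimitFixCocone c T)

theorem fixStr_naturality {S T : LCFunctor K K} (η : S ⟶ T) :
    S.obj.map (fixMap c η) ≫ η.hom.app _ ≫ fixStr c T = fixStr c S ≫ fixMap c η := by
  refine (isColimitOfPreserves S.obj (isColimitFixCocone c S)).hom_ext fun n => ?_
  have hleft : S.obj.map (fixι c S n) ≫ S.obj.map (fixMap c η) ≫ η.hom.app _ ≫ fixStr c T =
      iterMap c η.hom (n + 1) ≫ fixι c T (n + 1) := by
    rw [← S.obj.map_comp_assoc, fixι_fixMap, S.obj.map_comp_assoc, η.hom.naturality_assoc]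
    exact (congrArg (fun g => S.obj.map (iterMap c η.hom n) ≫ η.hom.app _ ≫ g)
      (map_chainι_colimitStr c (isColimitFixCocone c T) n)).trans (Category.assoc _ _ _).symm
  have hright : S.obj.map (fixι c S n) ≫ fixStr c S ≫ fixMap c η =
      fixι c S (n + 1) ≫ fixMap c η :=
    map_chainι_colimitStr_assoc c (isColimitFixCocone c S) n (fixMap c η)
  exact hleft.trans ((fixι_fixMap c η (n + 1)).symm.trans hright.symm)

end FixAlgebra

open scoped CategoryTheory.Prod

section ParametrisedAlgebras

variable {D : Type u₁} [Category.{v₁} D] {E : Type u₂} [Category.{v₂} E]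

/-- `h` is a morphism, over the morphism `f : d ⟶ d'` of parameters, from the `T(d, -)`-algebra
`x` to the `T(d', -)`-algebra `y`. -/
def IsAlgebraHom (T : D × E ⥤ E) {d d' : D} (f : d ⟶ d') {X Y : E} (x : T.obj (d, X) ⟶ X)
    (y : T.obj (d', Y) ⟶ Y) (h : X ⟶ Y) : Prop :=
  T.map (f ×ₘ h) ≫ y = x ≫ h

namespace IsAlgebraHom

variable {T : D × E ⥤ E} {d d' d'' : D} {X Y Z : E} {x : T.obj (d, X) ⟶ X}
  {y : T.obj (d', Y) ⟶ Y} {z : T.obj (d'', Z) ⟶ Z} {f : d ⟶ d'} {g : d' ⟶ d''}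
  {h : X ⟶ Y} {k : Y ⟶ Z}

theorem comp (hh : IsAlgebraHom T f x y h) (hk : IsAlgebraHom T g y z k) :
    IsAlgebraHom T (f ≫ g) x z (h ≫ k) := by
  unfold IsAlgebraHom at *
  calc T.map ((f ≫ g) ×ₘ (h ≫ k)) ≫ z
    _ = T.map (f ×ₘ h) ≫ T.map (g ×ₘ k) ≫ z := T.map_comp_assoc (f ×ₘ h) (g ×ₘ k) z
    _ = x ≫ h ≫ k := by rw [hk, reassoc_of% hh]

theorem iff_id_restrict :
    IsAlgebraHom T f x y h ↔ IsAlgebraHom T (𝟙 d) x (T.map (f ×ₘ 𝟙 Y) ≫ y) h := by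
  simp only [IsAlgebraHom, ← T.map_comp_assoc, prod_comp, Category.id_comp, Category.comp_id]

end IsAlgebraHom

/-- A natural family of structure morphisms `T(d, R d) ⟶ R d` making each `R d` an initial algebra
of `T(d, -)`. -/
structure InitialAlgebraFamily (T : D × E ⥤ E) (R : D ⥤ E) where
  /-- The structure morphisms `T(d, R d) ⟶ R d`. -/
  str : (𝟭 D).prod' R ⋙ T ⟶ R
  /-- Initiality in each fibre. -/
  isInitial (d : D) :
    IsInitial (⟨R.obj d, str.app d⟩ : Endofunctor.Algebra ((Functor.curry.obj T).obj d))

namespace InitialAlgebraFamily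

variable {T : D × E ⥤ E} {R S : D ⥤ E}

def mkOfIff (str : (𝟭 D).prod' R ⋙ T ⟶ R)
    (desc : ∀ {d : D} {X : E}, (T.obj (d, X) ⟶ X) → (R.obj d ⟶ X))
    (isAlgebraHom_id_iff : ∀ {d : D} {X : E} (x : T.obj (d, X) ⟶ X) (h : R.obj d ⟶ X),
      IsAlgebraHom T (𝟙 d) (str.app d) x h ↔ h = desc x) : InitialAlgebraFamily T R where
  str := str
  isInitial _ := .ofUniqueHom (fun A => ⟨desc A.str, (isAlgebraHom_id_iff A.str _).2 rfl⟩)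
    fun A m => Endofunctor.Algebra.ext ((isAlgebraHom_id_iff A.str m.f).1 m.h)

variable (r : InitialAlgebraFamily T R) (s : InitialAlgebraFamily T S)

/-- The algebra morphism from `R d` to a `T(d, -)`-algebra. -/
def desc {d : D} {X : E} (x : T.obj (d, X) ⟶ X) : R.obj d ⟶ X :=
  ((r.isInitial d).to ⟨X, x⟩).f

theorem isAlgebraHom_desc {d : D} {X : E} (x : T.obj (d, X) ⟶ X) :
    IsAlgebraHom T (𝟙 d) (r.str.app d) x (r.desc x) :=
  ((r.isInitial d).to ⟨X, x⟩).h

theorem isAlgebraHom_map {d d' : D} (f : d ⟶ d') :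
    IsAlgebraHom T f (r.str.app d) (r.str.app d') (R.map f) :=
  r.str.naturality f

theorem hom_ext {d d' : D} {f : d ⟶ d'} {X : E} {x : T.obj (d', X) ⟶ X} {h k : R.obj d ⟶ X}
    (hh : IsAlgebraHom T f (r.str.app d) x h) (hk : IsAlgebraHom T f (r.str.app d) x k) :
    h = k := by
  rw [IsAlgebraHom.iff_id_restrict] at hh hk
  let A : Endofunctor.Algebra ((Functor.curry.obj T).obj d) := ⟨X, T.map (f ×ₘ 𝟙 X) ≫ x⟩
  exact congrArg Endofunctor.Algebra.Hom.f
    ((r.isInitial d).hom_ext (Y := A) ⟨h, hh⟩ ⟨k, hk⟩)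

theorem isAlgebraHom_id_iff {d : D} {X : E} (x : T.obj (d, X) ⟶ X) (h : R.obj d ⟶ X) :
    IsAlgebraHom T (𝟙 d) (r.str.app d) x h ↔ h = r.desc x :=
  ⟨fun hh => r.hom_ext hh (r.isAlgebraHom_desc x), fun hh => hh ▸ r.isAlgebraHom_desc x⟩

theorem isAlgebraHom_iff {d d' : D} (f : d ⟶ d') {X : E} (x : T.obj (d', X) ⟶ X)
    (h : R.obj d ⟶ X) : IsAlgebraHom T f (r.str.app d) x h ↔ h = R.map f ≫ r.desc x := by
  have hcomp : IsAlgebraHom T f (r.str.app d) x (R.map f ≫ r.desc x) := by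
    simpa only [Category.comp_id] using (r.isAlgebraHom_map f).comp (r.isAlgebraHom_desc x)
  exact ⟨fun hh => r.hom_ext hh hcomp, fun hh => hh ▸ hcomp⟩

def iso : R ≅ S :=
  NatIso.ofComponents
    (fun d => (Endofunctor.Algebra.forget _).mapIso
      ((r.isInitial d).uniqueUpToIso (s.isInitial d)))
    fun {d d'} f => by
      change R.map f ≫ r.desc (s.str.app d') = r.desc (s.str.app d) ≫ S.map f
      rw [eq_comm, ← r.isAlgebraHom_iff]
      simpa only [Category.id_comp] using
        (r.isAlgebraHom_desc (s.str.app d)).comp (s.isAlgebraHom_map f)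

end InitialAlgebraFamily

noncomputable def daggerInitialAlgebraFamily [OCategory D] [OCategory E] [SupportsCFP E]
    (c : CFPChoice E) (T : LCFunctor (D × E) E) :
    InitialAlgebraFamily T.obj (dagger c T).obj where
  str :=
    { app d := fixStr c ((Lam T).obj d)
      naturality d d' f := by
        refine Eq.trans ?_ (fixStr_naturality c ((Lam T).map f))
        let h : (dagger c T).obj.obj d ⟶ (dagger c T).obj.obj d' := fixMap c ((Lam T).map f)
        have hsplit : T.obj.map (f ×ₘ h) = T.obj.map (𝟙 d ×ₘ h) ≫ T.obj.map (f ×ₘ 𝟙 _) := by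
          rw [← T.obj.map_comp, prod_comp, Category.id_comp, Category.comp_id]
        exact (congrArg (· ≫ fixStr c ((Lam T).obj d')) hsplit).trans (Category.assoc _ _ _) }
  isInitial d := isInitialFixAlgebra c ((Lam T).obj d)

end ParametrisedAlgebras

namespace InitialAlgebraFamily

variable {A : Type u₁} [Category.{v₁} A] {B : Type u₂} [Category.{v₂} B]
variable {C : Type u₃} [Category.{v₃} C]
variable {F : A × B × C ⥤ B} {G : A × B × C ⥤ C} {Q : A × B ⥤ C} {P : A ⥤ B}
variable (q : InitialAlgebraFamily (prod.associator A B C ⋙ G) Q)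
  (p : InitialAlgebraFamily (((𝟭 (A × B)).prod' Q ⋙ prod.associator A B C) ⋙ F) P)

/-- The structure morphisms on `⟨P, Q ∘ ⟨id, P⟩⟩` for the functor `⟨F, G⟩`. -/
def bekicStr : (𝟭 A).prod' (P.prod' ((𝟭 A).prod' P ⋙ Q)) ⋙ F.prod' G ⟶
    P.prod' ((𝟭 A).prod' P ⋙ Q) :=
  NatTrans.prod' p.str (Functor.whiskerLeft ((𝟭 A).prod' P) q.str)

/-- The algebra of `F(a, -, Q(a, -))` obtained from an algebra of `⟨F, G⟩(a, -)` by precomposition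
with the morphism out of the initial algebra `Q(a, X)`. -/
def reduce {a : A} {X : B} {Y : C} (x : F.obj (a, X, Y) ⟶ X) (y : G.obj (a, X, Y) ⟶ Y) :
    F.obj (a, X, Q.obj (a, X)) ⟶ X :=
  F.map (𝟙 a ×ₘ 𝟙 X ×ₘ q.desc (d := (a, X)) y) ≫ x

theorem map_comp_reduce {a a' : A} (f : a ⟶ a') {b X : B} (h : b ⟶ X) {Y : C}
    (x : F.obj (a', X, Y) ⟶ X) (y : G.obj (a', X, Y) ⟶ Y) :
    F.map (f ×ₘ h ×ₘ Q.map (f ×ₘ h)) ≫ q.reduce x y =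
      F.map (f ×ₘ h ×ₘ (Q.map (f ×ₘ h) ≫ q.desc (d := (a', X)) y)) ≫ x := by
  simp only [reduce, ← F.map_comp_assoc, prod_comp, Category.comp_id]

theorem isAlgebraHom_bekicStr_iff {a : A} {Z : B × C} (z : (F.prod' G).obj (a, Z) ⟶ Z)
    (h : (P.prod' ((𝟭 A).prod' P ⋙ Q)).obj a ⟶ Z) :
    IsAlgebraHom (F.prod' G) (𝟙 a) ((bekicStr q p).app a) z h ↔
      h.1 = p.desc (q.reduce z.1 z.2) ∧
        h.2 = Q.map (𝟙 a ×ₘ h.1) ≫ q.desc (d := (a, Z.1)) z.2 := by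
  have hB : IsAlgebraHom (((𝟭 (A × B)).prod' Q ⋙ prod.associator A B C) ⋙ F) (𝟙 a)
      (p.str.app a) (q.reduce z.1 z.2) h.1 ↔ h.1 = p.desc (q.reduce z.1 z.2) :=
    p.isAlgebraHom_id_iff ..
  have hC : IsAlgebraHom (prod.associator A B C ⋙ G) (𝟙 a ×ₘ h.1) (q.str.app (a, P.obj a)) z.2
      h.2 ↔ h.2 = Q.map (𝟙 a ×ₘ h.1) ≫ q.desc (d := (a, Z.1)) z.2 :=
    q.isAlgebraHom_iff ..
  rw [← hB, ← hC, IsAlgebraHom, Prod.hom_ext_iff]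
  refine and_congr_left fun hG => ?_
  change F.map (𝟙 a ×ₘ h.1 ×ₘ h.2) ≫ z.1 = _ ↔
    F.map (𝟙 a ×ₘ h.1 ×ₘ Q.map (𝟙 a ×ₘ h.1)) ≫ q.reduce z.1 z.2 = _
  rw [map_comp_reduce, ← hC.1 hG]
  rfl

/-- Bekič's rule for families of initial algebras. -/
def bekic : InitialAlgebraFamily (F.prod' G) (P.prod' ((𝟭 A).prod' P ⋙ Q)) :=
  mkOfIff (bekicStr q p)
    (fun {a Z} z => p.desc (q.reduce z.1 z.2) ×ₘ
      (Q.map (𝟙 a ×ₘ p.desc (q.reduce z.1 z.2)) ≫ q.desc (d := (a, Z.1)) z.2))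
    fun z h => by
      rw [q.isAlgebraHom_bekicStr_iff p, Prod.hom_ext_iff]
      exact and_congr_right fun hB => by rw [hB]

end InitialAlgebraFamily

end OCat

theorem mainTheorem7
    {A : Type u₁} [Category.{v₁} A] [OCat.OCategory A]
    {B : Type u₂} [Category.{v₂} B] [OCat.OCategory B] [OCat.SupportsCFP B]
    {C : Type u₃} [Category.{v₃} C] [OCat.OCategory C] [OCat.SupportsCFP C]
    (cB : OCat.CFPChoice B) (cC : OCat.CFPChoice C) (cBC : OCat.CFPChoice (B × C))
    (F : OCat.LCFunctor (A × B × C) B) (G : OCat.LCFunctor (A × B × C) C) :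
    Nonempty (OCat.dagger cBC (F.pair G) ≅
      (OCat.dagger cB (OCat.bekicH cC F G)).pair
        (((OCat.LCFunctor.id A).pair (OCat.dagger cB (OCat.bekicH cC F G))).comp
          (OCat.daggerAssoc cC G))) :=
  let q := OCat.daggerInitialAlgebraFamily cC ((OCat.LCFunctor.assoc A B C).comp G)
  let p := OCat.daggerInitialAlgebraFamily cB (OCat.bekicH cC F G)
  ⟨ObjectProperty.isoMk _ ((OCat.daggerInitialAlgebraFamily cBC (F.pair G)).iso (q.bekic p))⟩
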